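/- Fix $n>1$ and $r>0$. A packing of $n$ disks of radius $r$ in $\mathbb{E}^2$ is a family of closed disks $\mathbf{B}[\mathbf{c}_i,r]$, $1\le i\le n$, with $\|\mathbf{c}_i-\mathbf{c}_j\|\ge 2r$ for all $i\ne j$; its contact number is the number of unordered pairs $\{i,j\}$, $i\neq j$, of tangent disks, i.e. with $\|\mathbf{c}_i-\mathbf{c}_j\|=2r$. The packing is totally separable if any two of its disks can be separated by a line that is disjoint from the interior of every disk of the packing. It is locally separable if each disk of the packing together with the disks of the packing tangent to it forms a totally separable packing. Let $c_{TS}(n,2)$ (resp. $c_{LS}(n,2)$) denote the largest contact number of totally separable (resp. locally separable) packings of $n$ disks of radius $r$ in $\mathbb{E}^2$, and let $c_{\mathbb{Z}^2}(n)$ denote the largest contact number of packings of $n$ disks of radius $\frac12$ in $\mathbb{E}^2$ all of whose centers have integer coordinates. Then all three maxima exist, and $$c_{\mathbb{Z}^2}(n)=c_{TS}(n,2)=c_{LS}(n,2)=\lfloor 2n-2\sqrt{n}\rfloor .$$ -/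

import Mathlib

/-- The closed balls of radius `r` centred at the points of `P` form a packing of `𝔼ᵈ`.
A family of congruent balls is described by the set of its centres. -/
def IsBallPacking (d : ℕ) (r : ℝ) (P : Set (EuclideanSpace ℝ (Fin d))) : Prop :=
  ∀ x ∈ P, ∀ y ∈ P, x ≠ y → 2 * r ≤ dist x y

/-- Hyperplane of `𝔼ᵈ` with normal vector `u` (nonzero where it is used) and offset `t`. -/
def hyperplane {d : ℕ} (u : EuclideanSpace ℝ (Fin d)) (t : ℝ) : Set (EuclideanSpace ℝ (Fin d)) :=
  {z | inner ℝ u z = t}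

/-- The hyperplane with normal `u` and offset `t` separates the sets `A` and `B`. Exchanging the
two sides amounts to replacing `(u, t)` by `(-u, -t)`. -/
def HyperplaneSeparates {d : ℕ} (u : EuclideanSpace ℝ (Fin d)) (t : ℝ)
    (A B : Set (EuclideanSpace ℝ (Fin d))) : Prop :=
  A ⊆ {z | inner ℝ u z ≤ t} ∧ B ⊆ {z | t ≤ inner ℝ u z}

/-- Totally separable packing: any two of the balls can be separated by a hyperplane that is
disjoint from the interior of each ball of the packing. -/
def IsTSPacking (d : ℕ) (r : ℝ) (P : Set (EuclideanSpace ℝ (Fin d))) : Prop :=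
  IsBallPacking d r P ∧
    ∀ x ∈ P, ∀ y ∈ P, x ≠ y →
      ∃ (u : EuclideanSpace ℝ (Fin d)) (t : ℝ), u ≠ 0 ∧
        HyperplaneSeparates u t (Metric.closedBall x r) (Metric.closedBall y r) ∧
        ∀ z ∈ P, Disjoint (hyperplane u t) (interior (Metric.closedBall z r))

/-- Locally separable packing: each ball together with the balls of the packing that are tangent
to it forms a totally separable packing. -/
def IsLSPacking (d : ℕ) (r : ℝ) (P : Set (EuclideanSpace ℝ (Fin d))) : Prop :=
  IsBallPacking d r P ∧ ∀ x ∈ P, IsTSPacking d r {y ∈ P | y = x ∨ dist x y = 2 * r}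

/-- Integer-lattice packing: a packing of balls of unit diameter whose centres have integer
coordinates. -/
def IsLatticePacking (d : ℕ) (P : Set (EuclideanSpace ℝ (Fin d))) : Prop :=
  IsBallPacking d (1 / 2) P ∧ ∀ x ∈ P, ∀ i, ∃ k : ℤ, x i = k

/-- The contact graph of the balls of radius `r` centred at `P`: two different balls are adjacent
iff they are tangent. -/
def contactGraph {d : ℕ} (r : ℝ) (P : Set (EuclideanSpace ℝ (Fin d))) : SimpleGraph P where
  Adj x y := x ≠ y ∧ dist x y = 2 * r
  symm := ⟨fun x y h => ⟨h.1.symm, by rw [dist_comm]; exact h.2⟩⟩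
  loopless := ⟨fun _ h => h.1 rfl⟩

/-- The contact number: the number of edges of the contact graph (used for finite `P`). -/
noncomputable def contactNumber {d : ℕ} (r : ℝ) (P : Set (EuclideanSpace ℝ (Fin d))) : ℕ :=
  (contactGraph r P).edgeSet.ncard

/-- The contact numbers of integer-lattice packings of `n` balls of unit diameter. -/
def latticeContactNumbers (d n : ℕ) : Set ℕ :=
  {m | ∃ P : Set (EuclideanSpace ℝ (Fin d)), P.Finite ∧ P.ncard = n ∧
    IsLatticePacking d P ∧ contactNumber (1 / 2) P = m}

/-- The contact numbers of totally separable packings of `n` balls of radius `r`. -/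
def tsContactNumbers (d : ℕ) (r : ℝ) (n : ℕ) : Set ℕ :=
  {m | ∃ P : Set (EuclideanSpace ℝ (Fin d)), P.Finite ∧ P.ncard = n ∧
    IsTSPacking d r P ∧ contactNumber r P = m}

/-- The contact numbers of locally separable packings of `n` balls of radius `r`. -/
def lsContactNumbers (d : ℕ) (r : ℝ) (n : ℕ) : Set ℕ :=
  {m | ∃ P : Set (EuclideanSpace ℝ (Fin d)), P.Finite ∧ P.ncard = n ∧
    IsLSPacking d r P ∧ contactNumber r P = m}

/-- The largest contact number of integer-lattice packings of `n` balls of unit diameter. -/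
noncomputable def cLattice (d n : ℕ) : ℕ := sSup (latticeContactNumbers d n)

/-- The largest contact number of totally separable packings of `n` balls of radius `r`. -/
noncomputable def cTS (d : ℕ) (r : ℝ) (n : ℕ) : ℕ := sSup (tsContactNumbers d r n)

/-- The largest contact number of locally separable packings of `n` balls of radius `r`. -/
noncomputable def cLS (d : ℕ) (r : ℝ) (n : ℕ) : ℕ := sSup (lsContactNumbers d r n)

/-! ### Chain partitions of finite strict orders -/

section Chains

variable {V : Type*}

/-! Upper bound: local separability forces contact edges at a common centre to make angles of at
least `π / 2` (`IsTSPacking.inner_nonpos`). A half-open quadrant contains no two such directions, so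
ascending edges split the centres into `A` chains and descending edges into `D` chains, with `n - A`
and `n - D` edges. Distinct points cannot be comparable in both orders, so a point is determined by
its two chains: `n ≤ A * D`. Hence the contact number is `2n - A - D ≤ 2n - 2√n` by AM-GM
(`exists_chain_numbers`). Lower bound: filling a lattice strip of width `w` row by row loses at most
`w + ⌈n / w⌉` from `2n`; `exists_width` makes this less than `2√n + 1`, so the floor is attained.
Lattice packings are totally separable, hence locally separable, so one bound serves all three
classes. -/

theorem exists_source_reflTransGen [Finite V] (R T : V → V → Prop) (hRT : ∀ x y, R x y → T x y)
    (hirr : ∀ x, ¬ T x x) (htrans : ∀ x y z, T x y → T y z → T x z) (v : V) :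
    ∃ s, (∀ u, ¬ R u s) ∧ Relation.ReflTransGen R s v := by
  have : IsTrans V T := ⟨htrans⟩
  have : Std.Irrefl T := ⟨hirr⟩
  have hwf : WellFounded T := Finite.wellFounded_of_trans_of_irrefl T
  induction v using hwf.induction with
  | _ v ih =>
    by_cases h : ∃ u, R u v
    · obtain ⟨u, hu⟩ := h
      obtain ⟨s, hs, hsu⟩ := ih u (hRT _ _ hu)
      exact ⟨s, hs, hsu.tail hu⟩
    · exact ⟨v, fun u hu => h ⟨u, hu⟩, .refl⟩

theorem eq_or_rel_of_reflTransGen {R T : V → V → Prop} (hRT : ∀ x y, R x y → T x y)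
    (htrans : ∀ x y z, T x y → T y z → T x z) {x y : V} (h : Relation.ReflTransGen R x y) :
    x = y ∨ T x y := by
  induction h with
  | refl => exact .inl rfl
  | tail _ hbc ih =>
    rcases ih with rfl | ih
    · exact .inr (hRT _ _ hbc)
    · exact .inr (htrans _ _ _ ih (hRT _ _ hbc))

/-- A finite strictly ordered set is partitioned into chains by a sub-relation of the order in
which every point has at most one successor and at most one predecessor; the number of chains is
the number of points minus the number of related pairs. -/
theorem exists_chain_partition [Finite V] (R T : V → V → Prop) (hRT : ∀ x y, R x y → T x y)
    (hirr : ∀ x, ¬ T x x) (htrans : ∀ x y z, T x y → T y z → T x z)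
    (hout : ∀ x y z, R x y → R x z → y = z) (hin : ∀ x y z, R y x → R z x → y = z) :
    ∃ (S : Set V) (f : V → S), {p : V × V | R p.1 p.2}.ncard + S.ncard = Nat.card V ∧
      ∀ v w, f v = f w → v = w ∨ T v w ∨ T w v := by
  choose f hf hfR using exists_source_reflTransGen R T hRT hirr htrans
  refine ⟨{s | ∀ u, ¬ R u s}, fun v => ⟨f v, hf v⟩, ?_, fun v w hvw => ?_⟩
  -- Chains are counted by their sources; by uniqueness of predecessors, related pairs correspond to
  -- non-sources.
  · have himg : Prod.snd '' {p : V × V | R p.1 p.2} = {s | ∀ u, ¬ R u s}ᶜ := by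
      ext v; simp
    rw [← Set.ncard_compl_add_ncard {s | ∀ u, ¬ R u s}, ← himg, Set.InjOn.ncard_image]
    rintro ⟨a, b⟩ hab ⟨c, d⟩ hcd (rfl : b = d)
    exact Prod.ext (hin _ _ _ hab hcd) rfl
  · have hv := hfR v
    rw [Subtype.mk.inj hvw] at hv
    rcases Relation.ReflTransGen.total_of_right_unique (fun x y z => hout x y z) hv (hfR w)
      with h | h <;> rcases eq_or_rel_of_reflTransGen hRT htrans h with h | h <;> simp [h]

end Chains

/-! ### Ascending and descending contacts -/

section Quadrants

/-- The difference `y - x` lies in the half-open first quadrant. -/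
def Ascends (x y : EuclideanSpace ℝ (Fin 2)) : Prop := x 0 < y 0 ∧ x 1 ≤ y 1

/-- The difference `y - x` lies in the half-open fourth quadrant. -/
def Descends (x y : EuclideanSpace ℝ (Fin 2)) : Prop := x 0 ≤ y 0 ∧ y 1 < x 1

theorem quadrant_cases {x y : EuclideanSpace ℝ (Fin 2)} (h : x ≠ y) :
    Ascends x y ∨ Descends x y ∨ Ascends y x ∨ Descends y x := by
  have : x 0 ≠ y 0 ∨ x 1 ≠ y 1 := by
    by_contra! hc
    exact h (by ext i; fin_cases i <;> simp [hc.1, hc.2])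
  unfold Ascends Descends
  grind

theorem contactNumber_eq_ascends_add_descends (r : ℝ) {P : Set (EuclideanSpace ℝ (Fin 2))}
    (hP : P.Finite) :
    contactNumber r P =
      {p : P × P | (contactGraph r P).Adj p.1 p.2 ∧ Ascends p.1 p.2}.ncard +
      {p : P × P | (contactGraph r P).Adj p.1 p.2 ∧ Descends p.1 p.2}.ncard := by
  have := hP.to_subtype
  rw [← Set.ncard_union_eq, contactNumber]
  · symm
    refine Set.ncard_congr (fun p _ => s(p.1, p.2)) ?_ ?_ ?_
    · rintro ⟨a, b⟩ (h | h) <;> exact h.1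
    · rintro ⟨a, b⟩ ⟨c, d⟩ h h' heq
      simp only [Set.mem_union, Set.mem_ofPred_eq, Ascends, Descends] at h h'
      rcases Sym2.eq_iff.1 heq with ⟨rfl, rfl⟩ | ⟨rfl, rfl⟩
      · rfl
      · grind
    · intro e
      induction e with | _ a b => ?_
      intro (h : (contactGraph r P).Adj a b)
      rcases quadrant_cases (fun he => h.1 (Subtype.ext he)) with h' | h' | h' | h'
      · exact ⟨(a, b), .inl ⟨h, h'⟩, rfl⟩
      · exact ⟨(a, b), .inr ⟨h, h'⟩, rfl⟩
      · exact ⟨(b, a), .inl ⟨h.symm, h'⟩, Sym2.eq_swap⟩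
      · exact ⟨(b, a), .inr ⟨h.symm, h'⟩, Sym2.eq_swap⟩
  · rw [Set.disjoint_left]
    rintro p ⟨-, h⟩ ⟨-, h'⟩
    exact absurd h.2 h'.2.not_ge

/-- If any two edges of the contact graph at a common vertex enclose an angle of at least `π / 2`,
then the contact graph is the union of `A` ascending and `D` descending chains, and any ascending
chain meets any descending one in at most one point. -/
theorem exists_chain_numbers (r : ℝ) {P : Set (EuclideanSpace ℝ (Fin 2))} (hP : P.Finite)
    (hang : ∀ x y z : P, (contactGraph r P).Adj x y → (contactGraph r P).Adj x z → y ≠ z →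
      inner ℝ (y.1 - x.1) (z.1 - x.1) ≤ 0) :
    ∃ A D : ℕ, contactNumber r P + A + D = 2 * P.ncard ∧ P.ncard ≤ A * D := by
  have := hP.to_subtype
  have hang' : ∀ x y z : P, (contactGraph r P).Adj x y → (contactGraph r P).Adj x z →
      0 < (y.1 0 - x.1 0) * (z.1 0 - x.1 0) + (y.1 1 - x.1 1) * (z.1 1 - x.1 1) → y = z := by
    intro x y z hy hz hpos
    by_contra hne
    have := hang x y z hy hz hne
    simp only [PiLp.inner_apply, Fin.sum_univ_two, PiLp.sub_apply, RCLike.inner_apply,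
      conj_trivial] at this
    linarith
  obtain ⟨S, f, hS, hf⟩ := exists_chain_partition
    (fun x y : P => (contactGraph r P).Adj x y ∧ Ascends x y) (fun x y : P => Ascends x y)
    (fun _ _ h => h.2) (fun _ h => h.1.false)
    (fun _ _ _ h h' => ⟨h.1.trans h'.1, h.2.trans h'.2⟩)
    -- Two vectors in one half-open quadrant have positive inner product, so successors and
    -- predecessors are unique.
    (fun x y z hy hz => hang' x y z hy.1 hz.1 (by
      have := mul_pos (sub_pos.2 hy.2.1) (sub_pos.2 hz.2.1)
      have := mul_nonneg (sub_nonneg.2 hy.2.2) (sub_nonneg.2 hz.2.2)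
      linarith))
    (fun x y z hy hz => hang' x y z hy.1.symm hz.1.symm (by
      have := mul_pos (sub_pos.2 hy.2.1) (sub_pos.2 hz.2.1)
      have := mul_nonneg (sub_nonneg.2 hy.2.2) (sub_nonneg.2 hz.2.2)
      linarith))
  obtain ⟨S', f', hS', hf'⟩ := exists_chain_partition
    (fun x y : P => (contactGraph r P).Adj x y ∧ Descends x y) (fun x y : P => Descends x y)
    (fun _ _ h => h.2) (fun _ h => h.2.false)
    (fun _ _ _ h h' => ⟨h.1.trans h'.1, h'.2.trans h.2⟩)
    (fun x y z hy hz => hang' x y z hy.1 hz.1 (by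
      have := mul_nonneg (sub_nonneg.2 hy.2.1) (sub_nonneg.2 hz.2.1)
      have := mul_pos (sub_pos.2 hy.2.2) (sub_pos.2 hz.2.2)
      linarith))
    (fun x y z hy hz => hang' x y z hy.1.symm hz.1.symm (by
      have := mul_nonneg (sub_nonneg.2 hy.2.1) (sub_nonneg.2 hz.2.1)
      have := mul_pos (sub_pos.2 hy.2.2) (sub_pos.2 hz.2.2)
      linarith))
  refine ⟨S.ncard, S'.ncard, ?_, ?_⟩
  · rw [contactNumber_eq_ascends_add_descends r hP, ← Nat.card_coe_set_eq P]
    omega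
  · rw [← Nat.card_coe_set_eq, ← Nat.card_coe_set_eq, ← Nat.card_coe_set_eq, ← Nat.card_prod]
    refine Nat.card_le_card_of_injective (fun v => (f v, f' v)) fun v w hvw => ?_
    obtain ⟨h1, h2⟩ := Prod.ext_iff.1 hvw
    rcases hf v w h1 with h | h
    · exact h
    rcases hf' v w h2 with h' | h'
    · exact h'
    unfold Ascends Descends at *
    grind

end Quadrants

/-! ### Angles and the upper bound in separable packings -/

section LocallySeparable

variable {d : ℕ}

theorem IsTSPacking.mono {r : ℝ} {P Q : Set (EuclideanSpace ℝ (Fin d))} (h : IsTSPacking d r P)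
    (hQ : Q ⊆ P) : IsTSPacking d r Q := by
  refine ⟨fun x hx y hy => h.1 x (hQ hx) y (hQ hy), fun x hx y hy hxy => ?_⟩
  obtain ⟨u, t, hu, hs, hd⟩ := h.2 x (hQ hx) y (hQ hy) hxy
  exact ⟨u, t, hu, hs, fun z hz => hd z (hQ hz)⟩

theorem IsTSPacking.isLSPacking {r : ℝ} {P : Set (EuclideanSpace ℝ (Fin d))}
    (h : IsTSPacking d r P) : IsLSPacking d r P :=
  ⟨h.1, fun _ _ => h.mono fun _ hy => hy.1⟩

theorem le_abs_inner_sub_of_disjoint {r : ℝ} (hr : 0 < r) {u z : EuclideanSpace ℝ (Fin d)} {t : ℝ}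
    (hu : u ≠ 0) (h : Disjoint (hyperplane u t) (interior (Metric.closedBall z r))) :
    r * ‖u‖ ≤ |inner ℝ u z - t| := by
  by_contra! hc
  have hu' : 0 < ‖u‖ := norm_pos_iff.2 hu
  rw [interior_closedBall _ hr.ne'] at h
  -- The foot of the perpendicular from `z` to the hyperplane.
  refine Set.disjoint_left.1 h (?_ : z + ((t - inner ℝ u z) / ‖u‖ ^ 2) • u ∈ _) ?_
  · simp only [hyperplane, Set.mem_ofPred_eq, inner_add_right, inner_smul_right,
      real_inner_self_eq_norm_sq]
    field_simp
    ring
  · rw [mem_ball_iff_norm, add_sub_cancel_left, norm_smul, Real.norm_eq_abs, abs_div,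
      abs_of_pos (by positivity : 0 < ‖u‖ ^ 2), abs_sub_comm]
    rw [div_mul_eq_mul_div, div_lt_iff₀ (by positivity)]
    nlinarith

/-- A hyperplane separating two tangent balls must be their common tangent hyperplane, so `u` is
parallel to `y - x`. The ball at `z` lies on one side of it: on the side of `y`, tangency to `x`
forces `z = y`; on the side of `x`, the angle is not acute. -/
theorem IsTSPacking.inner_nonpos {r : ℝ} (hr : 0 < r) {P : Set (EuclideanSpace ℝ (Fin d))}
    (h : IsTSPacking d r P) {x y z : EuclideanSpace ℝ (Fin d)} (hx : x ∈ P) (hy : y ∈ P)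
    (hz : z ∈ P) (hxy : dist x y = 2 * r) (hxz : dist x z = 2 * r) (hyz : y ≠ z) :
    inner ℝ (y - x) (z - x) ≤ 0 := by
  have hne : x ≠ y := by
    rintro rfl
    rw [dist_self] at hxy
    linarith
  obtain ⟨u, t, hu, ⟨hsx, hsy⟩, hd⟩ := h.2 x hx y hy hne
  have hu' : 0 < ‖u‖ := norm_pos_iff.2 hu
  have hny : ‖y - x‖ = 2 * r := by rw [← hxy, dist_comm, dist_eq_norm]
  have hnz : ‖z - x‖ = 2 * r := by rw [← hxz, dist_comm, dist_eq_norm]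
  have hx1 : inner ℝ u (x + (r / ‖u‖) • u) ≤ t := hsx (by
    rw [mem_closedBall_iff_norm, add_sub_cancel_left, norm_smul, Real.norm_eq_abs,
      abs_of_pos (by positivity), div_mul_cancel₀ _ hu'.ne'])
  have hy1 : t ≤ inner ℝ u (y - (r / ‖u‖) • u) := hsy (by
    rw [mem_closedBall_iff_norm, sub_sub_cancel_left, norm_neg, norm_smul, Real.norm_eq_abs,
      abs_of_pos (by positivity), div_mul_cancel₀ _ hu'.ne'])
  have hru : r / ‖u‖ * ‖u‖ ^ 2 = r * ‖u‖ := by field_simp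
  rw [inner_add_right, inner_smul_right, real_inner_self_eq_norm_sq, hru] at hx1
  rw [inner_sub_right, inner_smul_right, real_inner_self_eq_norm_sq, hru] at hy1
  have hcy := real_inner_le_norm u (y - x)
  have hcz := real_inner_le_norm u (z - x)
  rw [hny] at hcy
  rw [hnz] at hcz
  -- Equality case of Cauchy–Schwarz.
  have hey := (inner_eq_norm_mul_iff_real (x := u) (y := y - x)).1 (by
    rw [hny]
    rw [inner_sub_right] at hcy ⊢
    linarith)
  rw [hny] at hey
  rw [inner_sub_right] at hcy hcz
  have hdz := le_abs_inner_sub_of_disjoint hr hu (hd z hz)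
  rcases le_abs.1 hdz with hdz | hdz
  · refine absurd ?_ hyz
    have hez := (inner_eq_norm_mul_iff_real (x := u) (y := z - x)).1 (by
      rw [hnz, inner_sub_right]
      linarith)
    rw [hnz, hey] at hez
    exact sub_left_injective (smul_right_injective _ hu'.ne' hez)
  · have hmul : ‖u‖ * inner ℝ (y - x) (z - x) = 2 * r * inner ℝ u (z - x) := by
      rw [← real_inner_smul_left, ← real_inner_smul_left, hey]
    rw [inner_sub_right (x := u)] at hmul
    nlinarith

theorem IsLSPacking.exists_chain_numbers {r : ℝ} (hr : 0 < r)
    {P : Set (EuclideanSpace ℝ (Fin 2))} (hP : P.Finite) (h : IsLSPacking 2 r P) :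
    ∃ A D : ℕ, contactNumber r P + A + D = 2 * P.ncard ∧ P.ncard ≤ A * D :=
  _root_.exists_chain_numbers r hP fun x y z hy hz hyz =>
    (h.2 x.1 x.2).inner_nonpos hr ⟨x.2, .inl rfl⟩ ⟨y.2, .inr hy.2⟩ ⟨z.2, .inr hz.2⟩ hy.2 hz.2
      fun he => hyz (Subtype.ext he)

theorem IsLSPacking.contactNumber_le {r : ℝ} (hr : 0 < r)
    {P : Set (EuclideanSpace ℝ (Fin 2))} (hP : P.Finite) (h : IsLSPacking 2 r P) :
    (contactNumber r P : ℝ) ≤ 2 * (P.ncard : ℝ) - 2 * √(P.ncard : ℝ) := by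
  obtain ⟨A, D, h1, h2⟩ := h.exists_chain_numbers hr hP
  have h1' : (contactNumber r P : ℝ) + A + D = 2 * P.ncard := by exact_mod_cast h1
  have h2' : (P.ncard : ℝ) ≤ A * D := by exact_mod_cast h2
  have : √(P.ncard : ℝ) ≤ ((A : ℝ) + D) / 2 :=
    Real.sqrt_le_iff.2 ⟨by positivity, by nlinarith [sq_nonneg ((A : ℝ) - D)]⟩
  linarith

end LocallySeparable

/-! ### Lattice packings and the extremal strip -/

section Lattice

theorem isBallPacking_of_scaled_lattice {d : ℕ} {r : ℝ} (hr : 0 < r)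
    {P : Set (EuclideanSpace ℝ (Fin d))} (hP : ∀ x ∈ P, ∀ i, ∃ k : ℤ, x i = 2 * r * k) :
    IsBallPacking d r P := by
  intro x hx y hy hxy
  obtain ⟨i, hi⟩ : ∃ i, x i ≠ y i := by
    by_contra! hc
    exact hxy (PiLp.ext hc)
  obtain ⟨k, hk⟩ := hP x hx i
  obtain ⟨l, hl⟩ := hP y hy i
  have hkl : k ≠ l := by
    rintro rfl
    exact hi (hk.trans hl.symm)
  have h1 : (1 : ℝ) ≤ |(k : ℝ) - l| := by exact_mod_cast Int.one_le_abs (sub_ne_zero.2 hkl)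
  have h2 : |x i - y i| ≤ dist x y := by
    rw [dist_eq_norm]
    exact PiLp.norm_apply_le (x - y) i
  rw [hk, hl, ← mul_sub, abs_mul, abs_of_pos (by positivity : 0 < 2 * r)] at h2
  nlinarith

theorem isTSPacking_of_scaled_lattice {d : ℕ} {r : ℝ} (hr : 0 < r)
    {P : Set (EuclideanSpace ℝ (Fin d))} (hP : ∀ x ∈ P, ∀ i, ∃ k : ℤ, x i = 2 * r * k) :
    IsTSPacking d r P := by
  refine ⟨isBallPacking_of_scaled_lattice hr hP, fun x hx y hy hxy => ?_⟩
  obtain ⟨i, hi⟩ : ∃ i, x i ≠ y i := by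
    by_contra! hc
    exact hxy (PiLp.ext hc)
  -- The sign `ε` orients the axis so that `x` comes before `y`.
  obtain ⟨ε, hε, hlt⟩ : ∃ ε : ℤ, |ε| = 1 ∧ (ε : ℝ) * x i < ε * y i := by
    rcases lt_or_gt_of_ne hi with h | h
    · exact ⟨1, by simp, by simpa using h⟩
    · exact ⟨-1, by simp, by simpa using h⟩
  have hεr : |(ε : ℝ)| = 1 := by exact_mod_cast hε
  have hball : ∀ c z : EuclideanSpace ℝ (Fin d), |(ε : ℝ) * z i - ε * c i| ≤ dist z c := by
    intro c z
    rw [← mul_sub, abs_mul, hεr, one_mul, dist_eq_norm]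
    exact PiLp.norm_apply_le (z - c) i
  have hlat : ∀ z ∈ P, ∃ k : ℤ, (ε : ℝ) * z i = 2 * r * k := by
    intro z hz
    obtain ⟨k, hk⟩ := hP z hz i
    exact ⟨ε * k, by rw [hk]; push_cast; ring⟩
  have hinner : ∀ z : EuclideanSpace ℝ (Fin d),
      inner ℝ (EuclideanSpace.single i (ε : ℝ)) z = ε * z i := by
    intro z
    simp [EuclideanSpace.inner_single_left]
  obtain ⟨k, hk⟩ := hlat x hx
  obtain ⟨l, hl⟩ := hlat y hy
  have hkl : k + 1 ≤ l := by
    rw [hk, hl] at hlt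
    exact_mod_cast lt_of_mul_lt_mul_left hlt (by positivity)
  have hkl' : (k : ℝ) + 1 ≤ l := by exact_mod_cast hkl
  -- The hyperplane midway between the lattice layer of `x` and the next one is at distance at least
  -- `r` from every lattice point.
  refine ⟨EuclideanSpace.single i (ε : ℝ), 2 * r * k + r, ?_, ⟨fun z hz => ?_, fun z hz => ?_⟩,
    fun z hz => ?_⟩
  · intro h0
    have : (ε : ℝ) = 0 := by simpa using h0
    simp [this] at hεr
  · have := abs_le.1 ((hball x z).trans hz)
    simp only [Set.mem_ofPred_eq, hinner]
    linarith
  · have := abs_le.1 ((hball y z).trans hz)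
    simp only [Set.mem_ofPred_eq, hinner]
    nlinarith
  · rw [interior_closedBall _ hr.ne', Set.disjoint_left]
    intro w hw hwz
    have h1 : (ε : ℝ) * w i = 2 * r * k + r := (hinner w).symm.trans hw
    obtain ⟨m, hm⟩ := hlat z hz
    have h2 := abs_lt.1 ((hball z w).trans_lt hwz)
    rw [h1, hm] at h2
    rcases le_or_gt m k with h | h
    · have : (m : ℝ) ≤ k := by exact_mod_cast h
      nlinarith
    · have : (k : ℝ) + 1 ≤ m := by exact_mod_cast h
      nlinarith

theorem IsLatticePacking.isTSPacking {d : ℕ} {P : Set (EuclideanSpace ℝ (Fin d))}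
    (h : IsLatticePacking d P) : IsTSPacking d (1 / 2) P :=
  isTSPacking_of_scaled_lattice (by norm_num) fun x hx i => by simpa using h.2 x hx i

/-- The `i`-th point in the row-by-row enumeration of a strip of width `w` of the square lattice
of mesh `2 * r`. -/
noncomputable def stripPoint (r : ℝ) (w i : ℕ) : EuclideanSpace ℝ (Fin 2) :=
  !₂[2 * r * (i % w : ℕ), 2 * r * (i / w : ℕ)]

theorem stripPoint_injective {r : ℝ} (hr : 0 < r) (w : ℕ) :
    Function.Injective (stripPoint r w) := by
  intro i j hij
  have h0 := congrFun (congrArg WithLp.ofLp hij) 0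
  have h1 := congrFun (congrArg WithLp.ofLp hij) 1
  simp only [stripPoint, Fin.isValue, Matrix.cons_val_zero, Matrix.cons_val_one, mul_eq_mul_left_iff,
    Nat.cast_inj, mul_eq_zero, OfNat.ofNat_ne_zero, hr.ne', or_false] at h0 h1
  rw [← Nat.mod_add_div i w, ← Nat.mod_add_div j w, h0, h1]

/-- Bounds the number of row starts in the strip; the right side is `⌈n / w⌉`. -/
theorem card_filter_dvd_range_le (n w : ℕ) (hw : 0 < w) :
    ((Finset.range n).filter (fun i => i % w = 0)).card ≤ (n + w - 1) / w := by
  rw [← Finset.card_range ((n + w - 1) / w)]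
  refine Finset.card_le_card_of_injOn (fun i => i / w) (fun i hi => ?_) (fun i hi j hj hij => ?_)
  · simp only [Finset.coe_filter, Finset.mem_range, Set.mem_ofPred_eq] at hi
    simp only [Finset.coe_range, Set.mem_Iio]
    rw [Nat.lt_iff_add_one_le, Nat.le_div_iff_mul_le hw, add_mul, one_mul]
    have := Nat.div_mul_le_self i w
    omega
  · simp only [Finset.coe_filter, Finset.mem_range, Set.mem_ofPred_eq] at hi hj
    rw [← Nat.mod_add_div i w, ← Nat.mod_add_div j w, hi.2, hj.2]
    simp only at hij
    rw [hij]

theorem card_le_ncard_adj {r : ℝ} (hr : 0 < r) {P : Set (EuclideanSpace ℝ (Fin 2))}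
    (hP : P.Finite) (T : EuclideanSpace ℝ (Fin 2) → EuclideanSpace ℝ (Fin 2) → Prop)
    (I : Finset ℕ) (a b : ℕ → EuclideanSpace ℝ (Fin 2)) (ha : ∀ i ∈ I, a i ∈ P)
    (hb : ∀ i ∈ I, b i ∈ P) (hinj : Function.Injective b)
    (hab : ∀ i ∈ I, dist (a i) (b i) = 2 * r ∧ T (a i) (b i)) :
    I.card ≤ {p : P × P | (contactGraph r P).Adj p.1 p.2 ∧ T p.1 p.2}.ncard := by
  have := hP.to_subtype
  rw [← Set.ncard_coe_finset, ← Nat.card_coe_set_eq, ← Nat.card_coe_set_eq]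
  refine Nat.card_le_card_of_injective
    (fun i : I => ⟨(⟨a i, ha i i.2⟩, ⟨b i, hb i i.2⟩), ⟨fun h => ?_, (hab i i.2).1⟩,
      (hab i i.2).2⟩) fun i j hij => ?_
  · have h1 := (hab i i.2).1
    rw [show a i = b i from congrArg Subtype.val h, dist_self] at h1
    linarith
  · exact Subtype.ext (hinj (congrArg (fun p => p.1.2.1) hij))

theorem dist_stripPoint_pred {r : ℝ} (hr : 0 < r) {w i : ℕ} (h : i % w ≠ 0) :
    dist (stripPoint r w (i - 1)) (stripPoint r w i) = 2 * r ∧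
      Ascends (stripPoint r w (i - 1)) (stripPoint r w i) := by
  obtain ⟨k, rfl⟩ : ∃ k, i = k + 1 := Nat.exists_eq_succ_of_ne_zero (by rintro rfl; simp at h)
  have hd : (k + 1) / w = k / w :=
    Nat.succ_div_of_not_dvd fun hdvd => h (Nat.mod_eq_zero_of_dvd hdvd)
  have hm : (k + 1) % w = k % w + 1 := by
    have h1 := Nat.mod_add_div (k + 1) w
    have h2 := Nat.mod_add_div k w
    rw [hd] at h1
    linarith
  constructor
  · simp [EuclideanSpace.dist_eq, stripPoint, hm, hd, Real.dist_eq, mul_add, hr.le]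
  · simp [Ascends, stripPoint, hm, hd, hr]

theorem dist_stripPoint_sub {r : ℝ} (hr : 0 < r) {w i : ℕ} (hw : 0 < w) (h : w ≤ i) :
    dist (stripPoint r w i) (stripPoint r w (i - w)) = 2 * r ∧
      Descends (stripPoint r w i) (stripPoint r w (i - w)) := by
  obtain ⟨k, rfl⟩ := Nat.exists_eq_add_of_le' h
  constructor
  · simp [EuclideanSpace.dist_eq, stripPoint, hw, Real.dist_eq, mul_add, hr.le]
  · simp [Descends, stripPoint, hw, hr]

/-- A lower bound for the contact number of the first `n` points of a strip of width `w`. -/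
theorem le_contactNumber_stripPoint {r : ℝ} (hr : 0 < r) {w : ℕ} (hw : 0 < w) (n : ℕ) :
    2 * n ≤ contactNumber r (stripPoint r w '' Set.Iio n) + w + (n + w - 1) / w := by
  have hP : (stripPoint r w '' Set.Iio n).Finite := (Set.finite_Iio n).image _
  have hinj := stripPoint_injective hr w
  rw [contactNumber_eq_ascends_add_descends r hP]
  have hA := card_le_ncard_adj hr hP Ascends ((Finset.range n).filter (fun i => ¬ i % w = 0))
    (fun i => stripPoint r w (i - 1)) (stripPoint r w)
    (fun i hi => ⟨i - 1, by simp at hi ⊢; omega, rfl⟩) (fun i hi => ⟨i, by simp at hi ⊢; omega, rfl⟩)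
    hinj (fun i hi => dist_stripPoint_pred hr (Finset.mem_filter.1 hi).2)
  -- Truncated subtraction is harmless: if `n < w` there are no vertical contacts to count, and the
  -- term `w` absorbs the loss.
  have hD := card_le_ncard_adj hr hP Descends (Finset.range (n - w))
    (fun i => stripPoint r w (i + w)) (stripPoint r w)
    (fun i hi => ⟨i + w, by simp at hi ⊢; omega, rfl⟩) (fun i hi => ⟨i, by simp at hi ⊢; omega, rfl⟩)
    hinj (fun i _ => by simpa using dist_stripPoint_sub (i := i + w) hr hw (by omega))
  have hn := Finset.card_filter_add_card_filter_not (s := Finset.range n) (fun i => i % w = 0)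
  have hc := card_filter_dvd_range_le n w hw
  rw [Finset.card_range] at hn hD
  omega

theorem exists_width (n : ℕ) (hn : 0 < n) :
    ∃ w : ℕ, 0 < w ∧ (w : ℝ) + ((n + w - 1) / w : ℕ) < 2 * √(n : ℝ) + 1 := by
  -- The width is `v + 1 = ⌈√n⌉`; the number of rows is at most `v` or `v + 1` according as `n ≤ v(v
  -- + 1)` or not.
  obtain ⟨v, hv⟩ : ∃ v, v = Nat.sqrt (n - 1) := ⟨_, rfl⟩
  have h1 : v * v ≤ n - 1 := hv ▸ Nat.sqrt_le (n - 1)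
  have h2 : n - 1 < (v + 1) * (v + 1) := hv ▸ Nat.lt_succ_sqrt (n - 1)
  refine ⟨v + 1, by omega, ?_⟩
  rw [show n + (v + 1) - 1 = n + v by omega]
  rcases le_or_gt n ((v + 1) * v) with h | h
  · have h3 : (n + v) / (v + 1) ≤ v := by
      rw [← Nat.lt_add_one_iff, Nat.div_lt_iff_lt_mul (by omega)]
      nlinarith
    have h3' : (((n + v) / (v + 1) : ℕ) : ℝ) ≤ v := by exact_mod_cast h3
    have h4 : (v : ℝ) < √n := Real.lt_sqrt_of_sq_lt (by norm_cast; nlinarith [Nat.sub_add_cancel hn])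
    push_cast
    linarith
  · have h3 : (n + v) / (v + 1) ≤ v + 1 := by
      rw [← Nat.lt_add_one_iff, Nat.div_lt_iff_lt_mul (by omega)]
      nlinarith [Nat.sub_add_cancel hn]
    have h3' : (((n + v) / (v + 1) : ℕ) : ℝ) ≤ v + 1 := by exact_mod_cast h3
    have h' : ((v : ℝ) + 1) * v + 1 ≤ n := by exact_mod_cast h
    -- Integrality gives `n ≥ v² + v + 1 > (v + 1/2)²`.
    have h4 : (v : ℝ) + 1 / 2 < √n := Real.lt_sqrt_of_sq_lt (by nlinarith)
    push_cast
    linarith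

/-- An optimal packing with centres in the square lattice of mesh `2 * r`. -/
theorem exists_scaled_lattice_packing {r : ℝ} (hr : 0 < r) {n : ℕ} (hn : 0 < n) :
    ∃ P : Set (EuclideanSpace ℝ (Fin 2)), P.Finite ∧ P.ncard = n ∧
      (∀ x ∈ P, ∀ i, ∃ k : ℤ, x i = 2 * r * k) ∧
      contactNumber r P = ⌊2 * (n : ℝ) - 2 * √(n : ℝ)⌋₊ := by
  obtain ⟨w, hw, hlt⟩ := exists_width n hn
  have hfin : (stripPoint r w '' Set.Iio n).Finite := (Set.finite_Iio n).image _
  have hcard : (stripPoint r w '' Set.Iio n).ncard = n := by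
    rw [Set.ncard_image_of_injective _ (stripPoint_injective hr w), ← Finset.coe_Iio,
      Set.ncard_coe_finset, Nat.card_Iio]
  have hlat : ∀ x ∈ stripPoint r w '' Set.Iio n, ∀ i, ∃ k : ℤ, x i = 2 * r * k := by
    rintro _ ⟨j, -, rfl⟩ i
    fin_cases i
    · exact ⟨(j % w : ℕ), by simp only [stripPoint, Int.cast_natCast]; rfl⟩
    · exact ⟨(j / w : ℕ), by simp only [stripPoint, Int.cast_natCast]; rfl⟩
  refine ⟨_, hfin, hcard, hlat, ?_⟩
  have hle := (isTSPacking_of_scaled_lattice hr hlat).isLSPacking.contactNumber_le hr hfin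
  have hge : 2 * (n : ℝ) ≤ contactNumber r (stripPoint r w '' Set.Iio n) + w +
      ((n + w - 1) / w : ℕ) := by
    exact_mod_cast le_contactNumber_stripPoint hr hw n
  rw [hcard] at hle
  symm
  rw [Nat.floor_eq_iff ((Nat.cast_nonneg _).trans hle)]
  exact ⟨hle, by linarith⟩

end Lattice

/-! ### Equality of the three maxima -/

theorem corollary3 (n : ℕ) (hn : 1 < n) (r : ℝ) (hr : 0 < r) :
    (IsGreatest (latticeContactNumbers 2 n) (cLattice 2 n) ∧
      IsGreatest (tsContactNumbers 2 r n) (cTS 2 r n) ∧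
      IsGreatest (lsContactNumbers 2 r n) (cLS 2 r n)) ∧
    cLattice 2 n = cTS 2 r n ∧
    cTS 2 r n = cLS 2 r n ∧
    (cLS 2 r n : ℤ) = ⌊2 * (n : ℝ) - 2 * √(n : ℝ)⌋ := by
  have hls : ∀ {s : ℝ}, 0 < s →
      ⌊2 * (n : ℝ) - 2 * √(n : ℝ)⌋₊ ∈ upperBounds (lsContactNumbers 2 s n) := by
    rintro s hs _ ⟨P, hP, rfl, hLS, rfl⟩
    exact Nat.le_floor (hLS.contactNumber_le hs hP)
  have hL : IsGreatest (latticeContactNumbers 2 n) ⌊2 * (n : ℝ) - 2 * √(n : ℝ)⌋₊ := by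
    obtain ⟨P, hP, hc, hlat, hm⟩ :=
      exists_scaled_lattice_packing (r := 1 / 2) (by norm_num) (n := n) (by omega)
    refine ⟨⟨P, hP, hc, ⟨isBallPacking_of_scaled_lattice (by norm_num) hlat, fun x hx i => ?_⟩, hm⟩,
      ?_⟩
    · simpa using hlat x hx i
    · rintro _ ⟨Q, hQ, hQc, hQl, rfl⟩
      exact hls (by norm_num) ⟨Q, hQ, hQc, hQl.isTSPacking.isLSPacking, rfl⟩
  obtain ⟨P, hP, hc, hlat, hm⟩ := exists_scaled_lattice_packing hr (n := n) (by omega)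
  have hts := isTSPacking_of_scaled_lattice hr hlat
  have hT : IsGreatest (tsContactNumbers 2 r n) ⌊2 * (n : ℝ) - 2 * √(n : ℝ)⌋₊ := by
    refine ⟨⟨P, hP, hc, hts, hm⟩, ?_⟩
    rintro _ ⟨Q, hQ, hQc, hQt, rfl⟩
    exact hls hr ⟨Q, hQ, hQc, hQt.isLSPacking, rfl⟩
  have hS : IsGreatest (lsContactNumbers 2 r n) ⌊2 * (n : ℝ) - 2 * √(n : ℝ)⌋₊ :=
    ⟨⟨P, hP, hc, hts.isLSPacking, hm⟩, hls hr⟩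
  -- Needed to identify the natural-number floor with the integer floor.
  have hnonneg : 0 ≤ 2 * (n : ℝ) - 2 * √(n : ℝ) := by
    have := (Nat.cast_nonneg (α := ℝ) _).trans (hts.isLSPacking.contactNumber_le hr hP)
    rwa [hc] at this
  rw [cLattice, cTS, cLS, hL.csSup_eq, hT.csSup_eq, hS.csSup_eq]
  exact ⟨⟨hL, hT, hS⟩, rfl, rfl, Int.natCast_floor_eq_floor hnonneg⟩
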